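/- Let $G$ be a finite abelian group (written additively) of odd order, and for a finite subset $S \subseteq G$ let $\Sigma(S) = \{\sum_{x \in T} x : \emptyset \ne T \subseteq S\}$ denote the set of all sums of nonempty subsets of $S$. If $S$ is a subset of $G$ with $|S| = 6$ which is zero-sum free, i.e. $0 \notin \Sigma(S)$, then $|\Sigma(S)| \ge 20$. -/

import Mathlib

/-- `Σ(S)`: the set of all sums of nonempty subsets of the finite set `S`. -/
def subsetSums {G : Type*} [AddCommGroup G] (S : Finset G) : Set G :=
  {g | ∃ T : Finset G, T ⊆ S ∧ T.Nonempty ∧ ∑ x ∈ T, x = g}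

/-- `S` is zero-sum free if no nonempty subset of `S` has sum `0`. -/
def ZeroSumFree {G : Type*} [AddCommGroup G] (S : Finset G) : Prop :=
  (0 : G) ∉ subsetSums S

/-! ### Bit sets of coefficient vectors -/

namespace SubsetSumSearch

/-! Two subset sums of six elements coincide exactly when the difference of their indicator vectors,
a vector with entries in {-1, 0, 1}, has vanishing combination. So it suffices to find 21 indicator
vectors (the zero vector included) whose pairwise differences are all known to have nonzero
combination; removing the empty sum, which is 0, leaves 20.

Known nonvanishing vectors, with entries from -2 to 2, form a bit set. Distinctness and zero-sum
freeness supply the first ones, odd order allows doubling, and adding a known relation to a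
nonvanishing vector gives another. When these do not separate 21 sums, the search branches on
whether a further combination vanishes (`le_ncard_of_search`); greedy selection certifies each leaf
(`le_ncard_picks`).

Symmetry keeps the search small: if some relation a = b + c holds, or failing that some a + b = c +
d, it may be assumed to involve the last elements (`le_ncard_sums_of_relation`). Three kernel
evaluations cover the cases. -/

/-- The base five value of a list of digits. A list `v` with digits below five stands for the
coefficient vector whose entries are `d - 2` for `d` in `v`. -/
def code : List ℕ → ℕ
  | [] => 0
  | d :: v => d * 5 ^ v.length + code v

/-- The union of the translates of the bit set `P` by `d * w`, for `d` in `A`. -/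
def stack (A : List ℕ) (w P : ℕ) : ℕ :=
  A.foldr (fun d acc => (P <<< (d * w)) ||| acc) 0

/-- The bit set of the codes of the lists whose `i`-th digit lies in the `i`-th list. -/
def prodSet : List (List ℕ) → ℕ
  | [] => 1
  | A :: As => stack A (5 ^ As.length) (prodSet As)

/-- The digits to which the coefficient with digit `c` can be added without overflow. -/
def addable (c : ℕ) : List ℕ :=
  [0, 1, 2, 3, 4].filter fun d => Nat.ble 2 (d + c) && Nat.ble (d + c) 6

/-- The translate of the bit set `D` by the coefficient vector `e`. Here `7812` is the code of the
zero vector of length six. -/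
def shift (e : List ℕ) (D : ℕ) : ℕ :=
  Nat.shiftRight (Nat.shiftLeft (Nat.land D (prodSet (e.map addable))) (Nat.sub (code e) 7812))
    (Nat.sub 7812 (code e))

/-- The opposite coefficient vector. -/
def neg (v : List ℕ) : List ℕ := v.map (4 - ·)

/-- The double of a coefficient vector with entries in `{-1, 0, 1}`. -/
def dbl (v : List ℕ) : List ℕ := v.map (2 * · - 2)

/-- Enlarges the bit set `D` by its translates by the relations in `E` and their opposites. -/
def close (E : List (List ℕ)) (D : ℕ) : ℕ :=
  E.foldr (fun e D => Nat.lor D (Nat.lor (shift e D) (shift (neg e) D))) D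

/-- Adds `± v` and `± 2 v` to the bit set `D`. -/
def bar (v : List ℕ) (D : ℕ) : ℕ :=
  D ||| ((2 ^ code v ||| 2 ^ code (neg v)) ||| (2 ^ code (dbl v) ||| 2 ^ code (neg (dbl v))))

/-- Greedily selects `k` indicator vectors coded in `c` with all differences coded in `D`; the gcd
isolates the lowest bit of `c`. -/
def separates (D : ℕ) : ℕ → ℕ → Bool
  | 0, _ => true
  | k + 1, c => bif Nat.beq c 0 then false
      else separates D k (Nat.land c (Nat.shiftRight (Nat.mul D (Nat.gcd c (Nat.pow 2 4000))) 7812))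

/-- The bit set of the codes of all indicator vectors. -/
def cube : ℕ := prodSet (List.replicate 6 [0, 1])

/-- Whether `k` belongs to the bit set `D`. -/
def mem (k D : ℕ) : Bool := Nat.beq (Nat.land 1 (Nat.shiftRight D k)) 1

/-- Decides the vectors of the list in turn. `E` holds vectors with vanishing combination, `D` codes
vectors with nonvanishing combination, and a branch ends when 21 subset sums are separated.
The bit operations are spelled as functions on `ℕ` to shorten the evaluation in the kernel. -/
def search : List (List ℕ) → List (List ℕ) → ℕ → Bool
  | [], _, D => separates D 21 cube
  | r :: rs, E, D =>
    bif mem (code r) D then search rs E D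
    else bif separates D 21 cube then true
    else bif search rs (r :: E) (close (r :: E) D) then search rs E (close E (bar r D))
    else false

/-- The coefficient vectors of length `n` with entries in `{-1, 0, 1}`. -/
def ternary : ℕ → List (List ℕ)
  | 0 => [[]]
  | n + 1 => (ternary n).flatMap fun v => [1 :: v, 2 :: v, 3 :: v]

/-- Bars the vectors with `p` entries `1` and `q` entries `-1`. -/
def barType (p q D : ℕ) : ℕ :=
  ((ternary 6).filter fun v => Nat.beq (v.count 3) p && Nat.beq (v.count 1) q).foldr bar D

/-- The bit set that results from barring all the listed types. -/
def barred (l : List (ℕ × ℕ)) : ℕ := l.foldr (fun t => barType t.1 t.2) 0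

/-- The candidate relations with support of size `k`, up to sign. -/
def relations (k : ℕ) : List (List ℕ) :=
  (ternary 6).filter fun v => Nat.beq (v.count 2) (6 - k) && Nat.ble 7812 (code v)
    && !(Nat.beq (v.count 1) 0)

/-- The vector with `p` entries `1` followed by `q` entries `-1`, at the end. -/
def vec (p q : ℕ) : List ℕ :=
  List.replicate (6 - (p + q)) 2 ++ (List.replicate p 3 ++ List.replicate q 1)

/-- The vectors on which the search branches. -/
def branching : List (List ℕ) := relations 3 ++ (relations 4 ++ relations 5)

/-- The types of relations that a zero-sum free family of distinct elements excludes. -/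
def freeTypes : List (ℕ × ℕ) := [(1, 1), (1, 0), (2, 0), (3, 0), (4, 0), (5, 0), (6, 0)]

/-! ### Codes and coefficient vectors -/

theorem code_lt (v : List ℕ) (hv : ∀ d ∈ v, d < 5) : code v < 5 ^ v.length := by
  induction v with
  | nil => simp [code]
  | cons d v ih =>
    have h1 := ih fun a ha => hv a (List.mem_cons_of_mem _ ha)
    have h2 : d ≤ 4 := by have := hv d List.mem_cons_self; omega
    have h3 : d * 5 ^ v.length ≤ 4 * 5 ^ v.length := Nat.mul_le_mul_right _ h2
    simp only [code, List.length_cons, pow_succ]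
    omega

theorem code_injective {u v : List ℕ} (hl : u.length = v.length) (hu : ∀ d ∈ u, d < 5)
    (hv : ∀ d ∈ v, d < 5) (h : code u = code v) : u = v := by
  induction u generalizing v with
  | nil => exact (List.length_eq_zero_iff.mp hl.symm).symm
  | cons a u ih =>
    cases v with
    | nil => simp at hl
    | cons b v =>
      have hl' : u.length = v.length := by simpa using hl
      have hu' : ∀ d ∈ u, d < 5 := fun d hd => hu d (List.mem_cons_of_mem _ hd)
      have hv' : ∀ d ∈ v, d < 5 := fun d hd => hv d (List.mem_cons_of_mem _ hd)
      have h1 := code_lt u hu'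
      have h2 := code_lt v hv'
      simp only [code] at h
      rw [hl'] at h h1
      have hab : a = b := by
        have e1 : (a * 5 ^ v.length + code u) / 5 ^ v.length = a := by
          rw [mul_comm, Nat.mul_add_div (by positivity), Nat.div_eq_of_lt h1, add_zero]
        have e2 : (b * 5 ^ v.length + code v) / 5 ^ v.length = b := by
          rw [mul_comm, Nat.mul_add_div (by positivity), Nat.div_eq_of_lt h2, add_zero]
        rw [← e1, ← e2, h]
      subst hab
      rw [ih hl' hu' hv' (by omega)]

theorem testBit_stack {A : List ℕ} {w P k : ℕ} (h : (stack A w P).testBit k) :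
    ∃ d ∈ A, d * w ≤ k ∧ P.testBit (k - d * w) := by
  induction A with
  | nil => simp [stack] at h
  | cons a A ih =>
    simp only [stack, List.foldr_cons, Nat.testBit_or, Nat.testBit_shiftLeft, Bool.or_eq_true,
      Bool.and_eq_true, decide_eq_true_eq] at h
    rcases h with h | h
    · exact ⟨a, List.mem_cons_self, h⟩
    · obtain ⟨d, hd, h⟩ := ih h
      exact ⟨d, List.mem_cons_of_mem _ hd, h⟩

theorem exists_of_testBit_prodSet {As : List (List ℕ)} {k : ℕ} (h : (prodSet As).testBit k) :
    ∃ v, List.Forall₂ (· ∈ ·) v As ∧ code v = k := by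
  induction As generalizing k with
  | nil =>
    refine ⟨[], List.Forall₂.nil, ?_⟩
    have : (1 : ℕ).testBit k = decide (0 = k) := Nat.testBit_two_pow (n := 0)
    rw [prodSet, this] at h
    simpa [code] using h
  | cons A As ih =>
    obtain ⟨d, hd, hk, h⟩ := testBit_stack h
    obtain ⟨v, hv, hc⟩ := ih h
    refine ⟨d :: v, List.Forall₂.cons hd hv, ?_⟩
    rw [code, hc, hv.length_eq]
    omega

variable {G : Type*} [AddCommGroup G]

/-- The combination `∑ (dᵢ - 2) xᵢ`. -/
def combo : List ℕ → List G → G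
  | d :: v, x :: xs => ((d : ℤ) - 2) • x + combo v xs
  | _, _ => 0

/-- The combination `∑ dᵢ xᵢ`. -/
def pick : List ℕ → List G → G
  | d :: v, x :: xs => d • x + pick v xs
  | _, _ => 0

/-- The digit bounds rule out carries, so adding vectors is adding codes, up to the code of the zero
vector, whose digits are all 2. -/
theorem exists_add {u e : List ℕ}
    (h : List.Forall₂ (fun a b => 2 ≤ a + b ∧ a + b ≤ 6) u e) (xs : List G) :
    ∃ w : List ℕ, w.length = u.length ∧ (∀ d ∈ w, d < 5) ∧
      code w + code (List.replicate u.length 2) = code u + code e ∧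
      combo w xs = combo u xs + combo e xs := by
  induction h generalizing xs with
  | nil => exact ⟨[], by simp [combo, code]⟩
  | @cons a b u e hab hue ih =>
    obtain ⟨w, hl, hw, hc, -⟩ := ih []
    have hcode : code ((a + b - 2) :: w) + code (List.replicate (a :: u).length 2)
        = code (a :: u) + code (b :: e) := by
      obtain ⟨c, hc'⟩ : ∃ c, a + b = c + 2 := ⟨a + b - 2, by omega⟩
      simp only [List.length_cons, List.replicate_succ, code, hl, List.length_replicate,
        ← hue.length_eq]
      have h5 : a * 5 ^ u.length + b * 5 ^ u.length = c * 5 ^ u.length + 2 * 5 ^ u.length := by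
        rw [← add_mul, hc', add_mul]
      rw [hc', Nat.add_sub_cancel]
      omega
    have hd : ∀ d ∈ (a + b - 2) :: w, d < 5 := by
      intro d hd
      rcases List.mem_cons.mp hd with rfl | hd
      · omega
      · exact hw d hd
    cases xs with
    | nil => exact ⟨_, by simp [hl], hd, hcode, by simp [combo]⟩
    | cons x xs =>
      obtain ⟨w', hl', hw', hc', hs⟩ := ih xs
      -- The digits do not depend on `xs`: the list obtained for the tail and the one obtained for
      -- the empty family have the same code.
      have : w' = w := code_injective (hl'.trans hl.symm) hw' hw (by omega)
      subst this
      refine ⟨_, by simp [hl], hd, hcode, ?_⟩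
      have hcast : ((a + b - 2 : ℕ) : ℤ) - 2 = ((a : ℤ) - 2) + ((b : ℤ) - 2) := by omega
      simp only [combo, hs, hcast, add_smul]
      abel

theorem exists_sub {b c : List ℕ} (hl : b.length = c.length) (hb : ∀ d ∈ b, d < 2)
    (hc : ∀ d ∈ c, d < 2) {xs : List G} :
    ∃ w : List ℕ, w.length = b.length ∧ (∀ d ∈ w, d < 5) ∧
      code w + code c = code b + code (List.replicate b.length 2) ∧
      combo w xs = pick b xs - pick c xs := by
  induction b generalizing c xs with
  | nil =>
    obtain rfl := List.length_eq_zero_iff.mp hl.symm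
    exact ⟨[], by simp [combo, pick, code]⟩
  | cons a b ih =>
    cases c with
    | nil => simp at hl
    | cons a' c =>
      have ha := hb a List.mem_cons_self
      have ha' := hc a' List.mem_cons_self
      have hl' : b.length = c.length := by simpa using hl
      obtain ⟨w, hw, hd, hk, hs⟩ := ih hl' (fun d hd => hb d (List.mem_cons_of_mem _ hd))
        (fun d hd => hc d (List.mem_cons_of_mem _ hd)) (xs := xs.tail)
      refine ⟨(a + 2 - a') :: w, by simp [hw], ?_, ?_, ?_⟩
      · intro d h
        rcases List.mem_cons.mp h with rfl | h
        · omega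
        · exact hd d h
      · obtain ⟨t, ht⟩ : ∃ t, a + 2 = t + a' := ⟨a + 2 - a', by omega⟩
        have h5 : a * 5 ^ c.length + 2 * 5 ^ c.length = t * 5 ^ c.length + a' * 5 ^ c.length := by
          rw [← add_mul, ht, add_mul]
        simp only [List.length_cons, List.replicate_succ, code, hw, List.length_replicate, hl', ht,
          Nat.add_sub_cancel] at hk ⊢
        omega
      · cases xs with
        | nil => simp [combo, pick]
        | cons x xs =>
          have hcast : ((a + 2 - a' : ℕ) : ℤ) - 2 = (a : ℤ) - a' := by omega
          simp only [List.tail_cons] at hs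
          simp only [combo, pick, hs, hcast, sub_smul, natCast_zsmul]
          abel

theorem combo_neg {v : List ℕ} (hv : ∀ d ∈ v, d < 5) (xs : List G) :
    combo (neg v) xs = -combo v xs := by
  induction v generalizing xs with
  | nil => simp [neg, combo]
  | cons d v ih =>
    cases xs with
    | nil => simp [neg, combo]
    | cons x xs =>
      have hd := hv d List.mem_cons_self
      have hcast : ((4 - d : ℕ) : ℤ) - 2 = -((d : ℤ) - 2) := by omega
      have := ih (fun a ha => hv a (List.mem_cons_of_mem _ ha)) xs
      simp only [neg] at this
      simp only [neg, List.map_cons, combo, hcast, neg_smul, this]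
      abel

theorem combo_dbl {v : List ℕ} (hv : ∀ d ∈ v, d ∈ [1, 2, 3]) (xs : List G) :
    combo (dbl v) xs = 2 • combo v xs := by
  induction v generalizing xs with
  | nil => simp [dbl, combo]
  | cons d v ih =>
    cases xs with
    | nil => simp [dbl, combo]
    | cons x xs =>
      have hd := hv d List.mem_cons_self
      have hcast : ((2 * d - 2 : ℕ) : ℤ) - 2 = 2 * ((d : ℤ) - 2) := by
        simp only [List.mem_cons, List.not_mem_nil, or_false] at hd
        omega
      have := ih (fun a ha => hv a (List.mem_cons_of_mem _ ha)) xs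
      simp only [dbl] at this
      simp only [dbl, List.map_cons, combo, hcast, this, mul_smul, smul_add]
      simp only [two_smul]

/-! ### Soundness of the bit set operations -/

/-- Every vector of length six coded in `D` has a nonzero combination. -/
def Sound (xs : List G) (D : ℕ) : Prop :=
  ∀ v : List ℕ, v.length = 6 → (∀ d ∈ v, d < 5) → D.testBit (code v) → combo v xs ≠ 0

theorem code_replicate_two : code (List.replicate 6 2) = 7812 := by decide

theorem Sound.lor {xs : List G} {D D' : ℕ} (h : Sound xs D) (h' : Sound xs D') :
    Sound xs (D ||| D') := by
  intro v hl hv hb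
  rw [Nat.testBit_or, Bool.or_eq_true] at hb
  exact hb.elim (h v hl hv) (h' v hl hv)

theorem Sound.two_pow {xs : List G} {v : List ℕ} (hl : v.length = 6) (hv : ∀ d ∈ v, d < 5)
    (h : combo v xs ≠ 0) : Sound xs (2 ^ code v) := by
  intro u hul hu hb
  rw [Nat.testBit_two_pow, decide_eq_true_eq] at hb
  rwa [← code_injective (hl.trans hul.symm) hv hu hb]

theorem Sound.shift {xs : List G} {D : ℕ} (h : Sound xs D) {e : List ℕ} (hl : e.length = 6)
    (he : combo e xs = 0) : Sound xs (shift e D) := by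
  intro v hvl hv hb
  -- With truncated subtraction at most one of the two shifts is nontrivial; together they translate
  -- by the signed amount `code e - 7812`.
  change ((D &&& prodSet (e.map addable)) <<< (code e - 7812) >>> (7812 - code e)).testBit _ at hb
  simp only [Nat.testBit_shiftRight, Nat.testBit_shiftLeft, Nat.testBit_and, Bool.and_eq_true,
    decide_eq_true_eq] at hb
  obtain ⟨hle, hD, hP⟩ := hb
  obtain ⟨u, hu, hc⟩ := exists_of_testBit_prodSet hP
  have hue : List.Forall₂ (fun a b => a < 5 ∧ 2 ≤ a + b ∧ a + b ≤ 6) u e := by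
    rw [List.forall₂_map_right_iff] at hu
    refine hu.imp fun a b hab => ?_
    simp only [addable, List.mem_filter, Bool.and_eq_true, Nat.ble_eq] at hab
    refine ⟨?_, hab.2⟩
    have := hab.1
    simp only [List.mem_cons, List.not_mem_nil, or_false] at this
    omega
  have hul : u.length = 6 := hue.length_eq.trans hl
  have hu5 : ∀ d ∈ u, d < 5 := by
    intro d hd
    obtain ⟨i, hi, rfl⟩ := List.getElem_of_mem hd
    exact ((List.forall₂_iff_get.mp hue).2 i hi (by omega)).1
  obtain ⟨w, hwl, hw, hcw, hs⟩ := exists_add (hue.imp fun a b hab => hab.2) xs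
  rw [hul, code_replicate_two] at hcw
  have hwv : w = v := code_injective (by omega) hw hv (by omega)
  rw [← hwv, hs, he, add_zero]
  rw [← hc] at hD
  exact h u hul hu5 hD

theorem Sound.close {xs : List G} {D : ℕ} (h : Sound xs D) {E : List (List ℕ)}
    (hE : ∀ e ∈ E, e.length = 6 ∧ (∀ d ∈ e, d < 5) ∧ combo e xs = 0) : Sound xs (close E D) := by
  induction E with
  | nil => exact h
  | cons e E ih =>
    have h' := ih fun e he => hE e (List.mem_cons_of_mem _ he)
    obtain ⟨hl, hd, he⟩ := hE e List.mem_cons_self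
    exact h'.lor ((h'.shift hl he).lor
      (h'.shift (by simpa [neg] using hl) (by rw [combo_neg hd, he, neg_zero])))

/-- Without 2-torsion, twice a nonzero combination is nonzero. -/
theorem Sound.bar (h2 : ∀ g : G, 2 • g = 0 → g = 0) {xs : List G} {D : ℕ} (h : Sound xs D)
    {v : List ℕ} (hl : v.length = 6) (hv : ∀ d ∈ v, d ∈ [1, 2, 3]) (hne : combo v xs ≠ 0) :
    Sound xs (bar v D) := by
  have hv5 : ∀ d ∈ v, d < 5 := fun d hd => by
    have := hv d hd
    simp only [List.mem_cons, List.not_mem_nil, or_false] at this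
    omega
  have hneg : ∀ {u : List ℕ}, ∀ d ∈ neg u, d < 5 := by
    intro u d hd
    obtain ⟨a, -, rfl⟩ := List.mem_map.mp hd
    omega
  have hdbl : ∀ d ∈ dbl v, d < 5 := by
    intro d hd
    obtain ⟨a, ha, rfl⟩ := List.mem_map.mp hd
    have := hv a ha
    simp only [List.mem_cons, List.not_mem_nil, or_false] at this
    omega
  have hne2 : combo (dbl v) xs ≠ 0 := by
    rw [combo_dbl hv]
    exact fun h0 => hne (h2 _ h0)
  refine h.lor (((Sound.two_pow hl hv5 hne).lor (Sound.two_pow ?_ hneg ?_)).lor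
    ((Sound.two_pow ?_ hdbl hne2).lor (Sound.two_pow ?_ hneg ?_)))
  · simpa [neg] using hl
  · rwa [combo_neg hv5, neg_ne_zero]
  · simpa [dbl] using hl
  · simpa [neg, dbl] using hl
  · rwa [combo_neg hdbl, neg_ne_zero]

/-! ### Counting subset sums -/

/-- The exponent `m` is the 2-adic valuation of `c`, which is below `N` because of the bit `j`. -/
theorem exists_gcd_two_pow_eq {c N j : ℕ} (hj : j < N) (hc : c.testBit j) :
    ∃ m, c.gcd (2 ^ N) = 2 ^ m ∧ c.testBit m := by
  obtain ⟨m, hm, hg⟩ := (Nat.dvd_prime_pow Nat.prime_two).mp (c.gcd_dvd_right (2 ^ N))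
  refine ⟨m, hg, ?_⟩
  obtain ⟨q, hq⟩ : 2 ^ m ∣ c := hg ▸ c.gcd_dvd_left (2 ^ N)
  have hmN : m < N := by
    refine lt_of_le_of_ne hm ?_
    rintro rfl
    rw [hq, Nat.testBit_two_pow_mul] at hc
    simp at hc
    omega
  rw [hq, Nat.testBit_two_pow_mul]
  simp only [ge_iff_le, le_refl, decide_true, Nat.sub_self, Bool.true_and, Nat.testBit_zero,
    decide_eq_true_eq]
  by_contra hodd
  have h2 : 2 ^ (m + 1) ∣ c := by
    rw [hq, pow_succ]
    exact mul_dvd_mul_left _ (by omega)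
  have := (Nat.dvd_gcd h2 (pow_dvd_pow 2 hmN)).trans hg.dvd
  have := (Nat.pow_dvd_pow_iff_le_right (by norm_num)).mp this
  omega

/-- The subset sums whose indicator vectors are coded in `c`. -/
def picks (xs : List G) (c : ℕ) : Set G :=
  {g | ∃ b : List ℕ, b.length = 6 ∧ (∀ d ∈ b, d < 2) ∧ c.testBit (code b) ∧ pick b xs = g}

/-- Each greedy step keeps only the vectors whose difference from the chosen one is coded in `D`.
Their sums all differ from the chosen sum, so the set of sums loses at least one element per step.
-/
theorem le_ncard_picks [Finite G] {xs : List G} {D : ℕ} (hD : Sound xs D) (k : ℕ) {c : ℕ}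
    (hc : ∀ m, c.testBit m → ∃ b : List ℕ, b.length = 6 ∧ (∀ d ∈ b, d < 2) ∧ code b = m)
    (h : separates D k c = true) : k ≤ (picks xs c).ncard := by
  induction k generalizing c with
  | zero => exact Nat.zero_le _
  | succ k ih =>
    simp only [separates] at h
    cases hz : Nat.beq c 0 with
    | true => simp [hz] at h
    | false =>
      rw [hz, cond_false] at h
      have hc0 : c ≠ 0 := fun h0 => by simp [h0] at hz
      obtain ⟨j, hj⟩ := Nat.exists_testBit_of_ne_zero hc0
      -- The largest code of an indicator vector is 1 + 5 + ... + 5^5 = 3906.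
      have hj4 : j < 4000 := by
        obtain ⟨b, hl, hb, rfl⟩ := hc j hj
        match b, hl with
        | [a₀, a₁, a₂, a₃, a₄, a₅], _ =>
          simp only [List.mem_cons, List.not_mem_nil, or_false, forall_eq_or_imp, forall_eq] at hb
          simp only [code, List.length_cons, List.length_nil]
          omega
      obtain ⟨m, hg, hm⟩ := exists_gcd_two_pow_eq hj4 hj
      set c' := Nat.land c (Nat.shiftRight (Nat.mul D (Nat.gcd c (Nat.pow 2 4000))) 7812) with hc'
      have hbit : ∀ i, c'.testBit i → c.testBit i ∧ m ≤ 7812 + i ∧ D.testBit (7812 + i - m) := by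
        intro i hi
        have heq : c' = c &&& ((D * 2 ^ m) >>> 7812) := by rw [hc', ← hg]; rfl
        rw [heq, Nat.testBit_and, Nat.testBit_shiftRight, Nat.testBit_mul_two_pow] at hi
        simpa only [Bool.and_eq_true, decide_eq_true_eq] using hi
      have hk := ih (fun i hi => hc i (hbit i hi).1) h
      obtain ⟨b, hbl, hb, hbm⟩ := hc m hm
      have hmem : pick b xs ∈ picks xs c := ⟨b, hbl, hb, by rwa [hbm], rfl⟩
      have hsub : picks xs c' ⊆ picks xs c \ {pick b xs} := by
        rintro g ⟨a, hal, ha, hat, rfl⟩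
        obtain ⟨hac, hle, hDa⟩ := hbit _ hat
        refine ⟨⟨a, hal, ha, hac, rfl⟩, fun heq => ?_⟩
        obtain ⟨w, hwl, hw, hwc, hs⟩ := exists_sub (hal.trans hbl.symm) ha hb (xs := xs)
        rw [hal, code_replicate_two, hbm] at hwc
        refine hD w (hwl.trans hal) hw ?_ ?_
        -- `w` encodes the difference of `a` and the chosen vector `b`, whose code is `m`.
        · rwa [show code w = 7812 + code a - m by omega]
        · rw [hs, sub_eq_zero]
          exact heq
      have h1 := Set.ncard_le_ncard hsub
      have h2 := Set.ncard_sdiff_singleton_add_one hmem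
      omega

theorem exists_of_testBit_cube {m : ℕ} (h : cube.testBit m) :
    ∃ b : List ℕ, b.length = 6 ∧ (∀ d ∈ b, d < 2) ∧ code b = m := by
  obtain ⟨b, hb, hm⟩ := exists_of_testBit_prodSet h
  have hl : b.length = 6 := by simpa using hb.length_eq
  refine ⟨b, hl, fun d hd => ?_, hm⟩
  obtain ⟨i, hi, rfl⟩ := List.getElem_of_mem hd
  have := (List.forall₂_iff_get.mp hb).2 i hi (by simpa using by omega)
  simp only [List.get_eq_getElem, List.getElem_replicate, List.mem_cons, List.not_mem_nil,
    or_false] at this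
  omega

theorem le_ncard_of_search [Finite G] (h2 : ∀ g : G, 2 • g = 0 → g = 0) {xs : List G}
    {rs E : List (List ℕ)} {D : ℕ} (hD : Sound xs D)
    (hrs : ∀ r ∈ rs, r.length = 6 ∧ ∀ d ∈ r, d ∈ [1, 2, 3])
    (hE : ∀ e ∈ E, e.length = 6 ∧ (∀ d ∈ e, d < 5) ∧ combo e xs = 0)
    (h : search rs E D = true) : 21 ≤ (picks xs cube).ncard := by
  induction rs generalizing E D with
  | nil => exact le_ncard_picks hD 21 (fun _ => exists_of_testBit_cube) h
  | cons r rs ih =>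
    have hrs' : ∀ r ∈ rs, r.length = 6 ∧ ∀ d ∈ r, d ∈ [1, 2, 3] :=
      fun r hr => hrs r (List.mem_cons_of_mem _ hr)
    obtain ⟨hrl, hr⟩ := hrs r List.mem_cons_self
    simp only [search] at h
    cases hm : mem (code r) D with
    | true => exact ih hD hrs' hE (by simpa [hm] using h)
    | false =>
      cases hs : separates D 21 cube with
      | true => exact le_ncard_picks hD 21 (fun _ => exists_of_testBit_cube) hs
      | false =>
        rw [hm, hs, cond_false, cond_false, Bool.cond_false_right, Bool.and_eq_true] at h
        by_cases h0 : combo r xs = 0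
        · have hE' : ∀ e ∈ r :: E, e.length = 6 ∧ (∀ d ∈ e, d < 5) ∧ combo e xs = 0 := by
            intro e he
            rcases List.mem_cons.mp he with rfl | he
            · refine ⟨hrl, fun d hd => ?_, h0⟩
              have := hr d hd
              simp only [List.mem_cons, List.not_mem_nil, or_false] at this
              omega
            · exact hE e he
          exact ih (hD.close hE') hrs' hE' h.1
        · exact ih ((hD.bar h2 hrl hr h0).close hE) hrs' hE h.2

open scoped List

/-! ### Relations between disjoint subfamilies -/

/-- The digits 3, 2, 1 stand for the coefficients 1, 0, -1, so `P` collects the positive terms and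
`Q` the negative ones. -/
theorem exists_combo_eq {v : List ℕ} {xs : List G} (hl : v.length = xs.length)
    (hv : ∀ d ∈ v, d ∈ [1, 2, 3]) :
    ∃ P Q : List G, P ++ Q <+~ xs ∧ P.length = v.count 3 ∧ Q.length = v.count 1 ∧
      combo v xs = P.sum - Q.sum := by
  induction v generalizing xs with
  | nil => exact ⟨[], [], by simp [combo]⟩
  | cons d v ih =>
    cases xs with
    | nil => simp at hl
    | cons x xs =>
      obtain ⟨P, Q, hs, hP, hQ, hc⟩ := ih (by simpa using hl)
        (fun a ha => hv a (List.mem_cons_of_mem _ ha))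
      have hd := hv d List.mem_cons_self
      simp only [List.mem_cons, List.not_mem_nil, or_false] at hd
      rcases hd with rfl | rfl | rfl
      · refine ⟨P, x :: Q, ?_, by simp [hP], by simp [hQ], ?_⟩
        · exact List.perm_middle.subperm.trans ((List.subperm_cons x).mpr hs)
        · simp only [combo, hc, List.sum_cons, Nat.cast_one]
          rw [show (1 : ℤ) - 2 = -1 by norm_num, neg_one_smul]
          abel
      · refine ⟨P, Q, hs.trans (List.sublist_cons_self x xs).subperm, by simp [hP], by simp [hQ], ?_⟩
        simp [combo, hc]
      · refine ⟨x :: P, Q, (List.subperm_cons x).mpr hs, by simp [hP], by simp [hQ], ?_⟩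
        simp only [combo, hc, List.sum_cons, Nat.cast_ofNat]
        rw [show (3 : ℤ) - 2 = 1 by norm_num, one_smul]
        abel

theorem exists_pick_eq {b : List ℕ} (hb : ∀ d ∈ b, d < 2) (xs : List G) :
    ∃ P : List G, P <+~ xs ∧ P.sum = pick b xs := by
  induction b generalizing xs with
  | nil => exact ⟨[], List.nil_subperm, by simp [pick]⟩
  | cons d b ih =>
    cases xs with
    | nil => exact ⟨[], List.nil_subperm, by simp [pick]⟩
    | cons x xs =>
      obtain ⟨P, hP, hs⟩ := ih (fun a ha => hb a (List.mem_cons_of_mem _ ha)) xs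
      have hd := hb d List.mem_cons_self
      interval_cases d
      · exact ⟨P, hP.trans (List.sublist_cons_self x xs).subperm, by simp [pick, hs]⟩
      · exact ⟨x :: P, (List.subperm_cons x).mpr hP, by simp [pick, hs]⟩

/-- No `p` members of the family have the same sum as `q` further ones. -/
def NoRelation (xs : List G) (p q : ℕ) : Prop :=
  ∀ P Q : List G, P ++ Q <+~ xs → P.length = p → Q.length = q → P.sum ≠ Q.sum

theorem mem_ternary {n : ℕ} {v : List ℕ} (h : v ∈ ternary n) :
    v.length = n ∧ ∀ d ∈ v, d ∈ [1, 2, 3] := by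
  induction n generalizing v with
  | zero => simp_all [ternary]
  | succ n ih =>
    obtain ⟨u, hu, hv⟩ := List.mem_flatMap.mp h
    obtain ⟨hl, hd⟩ := ih hu
    have key : ∀ c ∈ [1, 2, 3], v = c :: u → v.length = n + 1 ∧ ∀ d ∈ v, d ∈ [1, 2, 3] := by
      rintro c hc rfl
      refine ⟨by simp [hl], fun d hdm => ?_⟩
      rcases List.mem_cons.mp hdm with rfl | hdm
      · exact hc
      · exact hd d hdm
    simp only [List.mem_cons, List.not_mem_nil, or_false] at hv
    rcases hv with hv | hv | hv
    · exact key 1 (by simp) hv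
    · exact key 2 (by simp) hv
    · exact key 3 (by simp) hv

theorem Sound.barType (h2 : ∀ g : G, 2 • g = 0 → g = 0) {xs : List G} (hl : xs.length = 6)
    {p q D : ℕ} (hD : Sound xs D) (h : NoRelation xs p q) : Sound xs (barType p q D) := by
  have key : ∀ l : List (List ℕ), (∀ v ∈ l, v ∈ ternary 6 ∧ v.count 3 = p ∧ v.count 1 = q) →
      Sound xs (l.foldr SubsetSumSearch.bar D) := by
    intro l hmem
    induction l with
    | nil => exact hD
    | cons v l ih =>
      obtain ⟨hv, hp, hq⟩ := hmem v List.mem_cons_self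
      obtain ⟨hvl, hvd⟩ := mem_ternary hv
      refine (ih fun u hu => hmem u (List.mem_cons_of_mem _ hu)).bar h2 hvl hvd ?_
      obtain ⟨P, Q, hs, hP, hQ, hc⟩ := exists_combo_eq (hvl.trans hl.symm) hvd
      rw [hc, sub_ne_zero]
      exact h P Q hs (hP.trans hp) (hQ.trans hq)
  refine key _ fun v hv => ?_
  obtain ⟨hv, hpq⟩ := List.mem_filter.mp hv
  rw [Bool.and_eq_true] at hpq
  exact ⟨hv, Nat.eq_of_beq_eq_true hpq.1, Nat.eq_of_beq_eq_true hpq.2⟩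

theorem sound_barred (h2 : ∀ g : G, 2 • g = 0 → g = 0) {xs : List G} (hl : xs.length = 6)
    {l : List (ℕ × ℕ)} (h : ∀ t ∈ l, NoRelation xs t.1 t.2) : Sound xs (barred l) := by
  induction l with
  | nil => intro v _ _ hb; simp [barred] at hb
  | cons t l ih =>
    exact (ih fun t ht => h t (List.mem_cons_of_mem _ ht)).barType h2 hl (h t List.mem_cons_self)

theorem mem_branching {r : List ℕ} (h : r ∈ branching) :
    r.length = 6 ∧ ∀ d ∈ r, d ∈ [1, 2, 3] := by
  simp only [branching, List.mem_append, relations, List.mem_filter] at h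
  rcases h with h | h | h <;> exact mem_ternary h.1

/-! ### Sums of subfamilies and normalization of a relation -/

/-- The set of sums of subfamilies, the empty one included. -/
def sums (xs : List G) : Set G := {g | ∃ P : List G, P <+~ xs ∧ P.sum = g}

theorem le_ncard_sums_of_search [Finite G] (h2 : ∀ g : G, 2 • g = 0 → g = 0) {xs : List G}
    (hl : xs.length = 6) {l : List (ℕ × ℕ)} (h : ∀ t ∈ l, NoRelation xs t.1 t.2)
    {E : List (List ℕ)} (hE : ∀ e ∈ E, e.length = 6 ∧ (∀ d ∈ e, d < 5) ∧ combo e xs = 0)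
    (hs : search branching E (close E (barred l)) = true) : 21 ≤ (sums xs).ncard := by
  refine (le_ncard_of_search h2 ((sound_barred h2 hl h).close hE) (fun _ => mem_branching)
    hE hs).trans (Set.ncard_le_ncard ?_)
  rintro g ⟨b, -, hb, -, rfl⟩
  exact exists_pick_eq hb xs

theorem combo_append {u : List ℕ} {xs : List G} (hl : u.length = xs.length) (v : List ℕ)
    (ys : List G) : combo (u ++ v) (xs ++ ys) = combo u xs + combo v ys := by
  induction u generalizing xs with
  | nil =>
    obtain rfl := List.length_eq_zero_iff.mp hl.symm
    simp [combo]
  | cons d u ih =>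
    cases xs with
    | nil => simp at hl
    | cons x xs => simp [combo, ih (by simpa using hl), add_assoc]

theorem combo_replicate (d : ℕ) (xs : List G) :
    combo (List.replicate xs.length d) xs = ((d : ℤ) - 2) • xs.sum := by
  induction xs with
  | nil => simp [combo]
  | cons x xs ih => simp [combo, ih, List.replicate_succ, smul_add]

theorem NoRelation.of_perm {xs ys : List G} (hp : xs ~ ys) {p q : ℕ} (h : NoRelation xs p q) :
    NoRelation ys p q :=
  fun P Q hs => h P Q (hs.trans hp.symm.subperm)

/-- A relation may be moved to the end of the family. -/
theorem le_ncard_sums_of_relation [Finite G] (h2 : ∀ g : G, 2 • g = 0 → g = 0) {xs : List G}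
    (hl : xs.length = 6) {l : List (ℕ × ℕ)} (h : ∀ t ∈ l, NoRelation xs t.1 t.2)
    {p q : ℕ} (hrel : ¬ NoRelation xs p q)
    (hs : search branching [vec p q] (close [vec p q] (barred l)) = true) :
    21 ≤ (sums xs).ncard := by
  simp only [NoRelation, not_forall, not_not] at hrel
  obtain ⟨P, Q, ⟨T, hT, hTs⟩, rfl, rfl, hsum⟩ := hrel
  obtain ⟨R, hR⟩ := hTs.exists_perm_append
  have hp : xs ~ R ++ (P ++ Q) :=
    (hR.trans (hT.append_right R)).trans List.perm_append_comm
  have hlen := hp.length_eq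
  have hle : (R ++ (P ++ Q)).length = 6 := hlen.symm.trans hl
  have heq : sums xs = sums (R ++ (P ++ Q)) := by
    ext g
    exact exists_congr fun S => and_congr_left' hp.subperm_left
  rw [heq]
  refine le_ncard_sums_of_search h2 hle (fun t ht => (h t ht).of_perm hp) ?_ hs
  intro e he
  obtain rfl := List.mem_singleton.mp he
  simp only [List.length_append] at hle
  have hRl : 6 - (P.length + Q.length) = R.length := by omega
  refine ⟨by simp [vec]; omega, ?_, ?_⟩
  · intro d hd
    simp only [vec, List.mem_append, List.mem_replicate] at hd
    omega
  -- The blocks `R`, `P`, `Q` have coefficients 0, 1, -1, and `P` and `Q` have equal sums.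
  · rw [vec, hRl, combo_append (by simp), combo_append (by simp), combo_replicate,
      combo_replicate, combo_replicate, hsum]
    rw [← add_smul]
    simp

/-! ### The three computations and the case distinction -/

theorem search_three : search branching [vec 1 2] (close [vec 1 2] (barred freeTypes)) = true := by
  decide +kernel

theorem search_four :
    search branching [vec 2 2] (close [vec 2 2] (barred ((1, 2) :: freeTypes))) = true := by
  decide +kernel

theorem search_none : search branching [] (close [] (barred ((2, 2) :: (1, 2) :: freeTypes))) = true := by
  decide +kernel

/-- The cases are nested: once no relation of type (1, 2) exists, that type is barred in the
remaining searches, and likewise (2, 2) in the last one. -/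
theorem le_ncard_sums [Finite G] (h2 : ∀ g : G, 2 • g = 0 → g = 0) {xs : List G}
    (hl : xs.length = 6) (hnd : xs.Nodup) (h0 : ∀ P : List G, P <+~ xs → P ≠ [] → P.sum ≠ 0) :
    21 ≤ (sums xs).ncard := by
  have hpos : ∀ p, 0 < p → NoRelation xs p 0 := by
    intro p hp P Q hs hP hQ
    obtain rfl := List.length_eq_zero_iff.mp hQ
    rw [List.append_nil] at hs
    exact h0 P hs (List.length_pos_iff.mp (hP ▸ hp))
  have hone : NoRelation xs 1 1 := by
    intro P Q hs hP hQ
    obtain ⟨a, rfl⟩ := List.length_eq_one_iff.mp hP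
    obtain ⟨b, rfl⟩ := List.length_eq_one_iff.mp hQ
    obtain ⟨T, hT, hTs⟩ := hs
    have := hT.nodup_iff.mp (hnd.sublist hTs)
    simpa using this
  have hfree : ∀ t ∈ freeTypes, NoRelation xs t.1 t.2 := by
    intro t ht
    simp only [freeTypes, List.mem_cons, List.not_mem_nil, or_false] at ht
    rcases ht with rfl | rfl | rfl | rfl | rfl | rfl | rfl
    · exact hone
    all_goals exact hpos _ (by norm_num)
  by_cases h12 : NoRelation xs 1 2
  · have h12' : ∀ t ∈ (1, 2) :: freeTypes, NoRelation xs t.1 t.2 :=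
      List.forall_mem_cons.mpr ⟨h12, hfree⟩
    by_cases h22 : NoRelation xs 2 2
    · exact le_ncard_sums_of_search h2 hl (List.forall_mem_cons.mpr ⟨h22, h12'⟩) (by simp)
        search_none
    · exact le_ncard_sums_of_relation h2 hl h12' h22 search_four
  · exact le_ncard_sums_of_relation h2 hl hfree h12 search_three

end SubsetSumSearch

/-! ### From lists back to finite sets -/

theorem corollary1p3 {G : Type*} [AddCommGroup G] [Finite G] (hG : Odd (Nat.card G))
    (S : Finset G) (hS : ZeroSumFree S) (hcard : S.card = 6) :
    20 ≤ (subsetSums S).ncard := by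
  classical
  have h2 : ∀ g : G, 2 • g = 0 → g = 0 := by
    intro g hg
    have h1 : addOrderOf g ∣ Nat.gcd 2 (Nat.card G) :=
      Nat.dvd_gcd (addOrderOf_dvd_of_nsmul_eq_zero hg) (addOrderOf_dvd_natCard g)
    rw [Nat.Coprime.gcd_eq_one hG.coprime_two_left, Nat.dvd_one] at h1
    exact AddMonoid.addOrderOf_eq_one_iff.mp h1
  have hmem : ∀ P : List G, List.Subperm P S.toList → P ≠ [] → P.sum ∈ subsetSums S := by
    rintro P hP hne
    have hnd : P.Nodup := by
      obtain ⟨T, hT, hTs⟩ := hP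
      exact hT.nodup_iff.mp (S.nodup_toList.sublist hTs)
    refine ⟨P.toFinset, fun x hx => ?_, ?_, ?_⟩
    · exact Finset.mem_toList.mp (hP.subset (List.mem_toFinset.mp hx))
    · exact List.toFinset_nonempty_iff P |>.mpr hne
    · simpa using List.sum_toFinset id hnd
  have hsub : SubsetSumSearch.sums S.toList ⊆ insert 0 (subsetSums S) := by
    rintro g ⟨P, hP, rfl⟩
    by_cases hne : P = []
    · simp [hne]
    · exact Set.mem_insert_of_mem _ (hmem P hP hne)
  have h21 := SubsetSumSearch.le_ncard_sums h2 (by rw [Finset.length_toList, hcard]) S.nodup_toList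
    (fun P hP hne h0 => hS (h0 ▸ hmem P hP hne))
  have h1 := Set.ncard_le_ncard hsub
  -- The 21 sums include the empty one; since 0 is not a nonempty subset sum, exactly one is lost.
  rw [Set.ncard_insert_of_notMem hS] at h1
  omega
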